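/- Let $g\in L^\infty[-1/2,1/2]$ be real-valued and not a.e. equal to $0$, put $e_n(x)=e^{2\pi i n x}$, and let $$\mathcal F(g)=\{e_n : n\in\mathbb Z,\ n\ge 0\}\cup\{g\,e_n : n\in\mathbb Z,\ n<0\}\subset L^2[-1/2,1/2].$$ Write $\phi_n=e_n$ for $n\ge 0$ and $\phi_n=g\,e_n$ for $n<0$. Say that $\mathcal F(g)$ is complete if the only $f\in L^2[-1/2,1/2]$ with $\langle f,\phi_n\rangle=0$ for all $n\in\mathbb Z$ is $f=0$; that it is a frame if there are constants $0<A\le B<\infty$ with $A\|f\|^2\le\sum_{n\in\mathbb Z}|\langle f,\phi_n\rangle|^2\le B\|f\|^2$ for all $f\in L^2[-1/2,1/2]$; and that it is a Riesz basis if it is a frame and every $f\in L^2[-1/2,1/2]$ has a unique expansion $f=\sum_{n\in\mathbb Z}c_n\phi_n$ with complex coefficients $c_n$ (unconditional convergence in $L^2$). Then: 1. $\mathcal F(g)$ is complete. 2. The following are equivalent: (a) $\mathcal F(g)$ is a Riesz basis; (b) $\mathcal F(g)$ is a frame; (c) $0\notin[\operatorname{ess\,inf} g,\operatorname{ess\,sup}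 g]$. -/

import Mathlib

open MeasureTheory
open scoped ENNReal

noncomputable section

namespace WindowedExp

section Hilbert

variable {ι H : Type*} [NormedAddCommGroup H] [InnerProductSpace ℂ H]

/-- The only vector orthogonal to all `φ i` is zero. -/
def IsCompleteSystem (φ : ι → H) : Prop :=
  ∀ f : H, (∀ i, inner ℂ (φ i) f = 0) → f = 0

/-- There are `0 < A ≤ B < ∞` with `A ‖f‖² ≤ ∑ |⟨f, φ i⟩|² ≤ B ‖f‖²` for all `f`. -/
def IsFrame (φ : ι → H) : Prop :=
  ∃ A B : ℝ, 0 < A ∧ A ≤ B ∧ ∀ f : H,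
    Summable (fun i => ‖inner ℂ (φ i) f‖ ^ 2) ∧
    A * ‖f‖ ^ 2 ≤ ∑' i, ‖inner ℂ (φ i) f‖ ^ 2 ∧
    ∑' i, ‖inner ℂ (φ i) f‖ ^ 2 ≤ B * ‖f‖ ^ 2

/-- A frame such that every `f` has a unique expansion `f = ∑ c i • φ i`. -/
def IsRieszBasis (φ : ι → H) : Prop :=
  IsFrame φ ∧ ∀ f : H, ∃! c : ι → ℂ, HasSum (fun i => c i • φ i) f

end Hilbert

/-- Lebesgue measure on `[-1/2, 1/2]`. -/
abbrev μI : Measure ℝ := volume.restrict (Set.Icc (-1 / 2 : ℝ) (1 / 2))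

/-- The exponential `x ↦ e^{2 π i n x}`. -/
def e (n : ℤ) (x : ℝ) : ℂ := Complex.exp (2 * Real.pi * Complex.I * n * x)

theorem norm_e (n : ℤ) (x : ℝ) : ‖e n x‖ = 1 := by
  have h : (2 * Real.pi * Complex.I * n * x : ℂ) = ((2 * Real.pi * n * x : ℝ) : ℂ) * Complex.I := by
    push_cast; ring
  rw [e, h, Complex.norm_exp_ofReal_mul_I]

theorem continuous_e (n : ℤ) : Continuous (e n) := by
  unfold e; fun_prop

theorem memLp_e (n : ℤ) (p : ℝ≥0∞) : MemLp (e n) p μI :=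
  MemLp.of_bound (continuous_e n).aestronglyMeasurable 1 (ae_of_all _ fun x => (norm_e n x).le)

theorem memLp_mul_e {g : ℝ → ℂ} (hg : MemLp g 2 μI) (n : ℤ) :
    MemLp (fun x => g x * e n x) 2 μI :=
  hg.of_le (hg.1.mul (continuous_e n).aestronglyMeasurable)
    (ae_of_all _ fun x => by rw [norm_mul, norm_e, mul_one])

/-- The system `{e_n : n ≥ 0} ∪ {g e_n : n < 0}` in `L²[-1/2, 1/2]`, indexed by `n ∈ ℤ`. -/
def system (g : ℝ → ℂ) (hg : MemLp g 2 μI) (n : ℤ) : Lp ℂ 2 μI :=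
  if 0 ≤ n then (memLp_e n 2).toLp (e n) else (memLp_mul_e hg n).toLp (fun x => g x * e n x)

theorem memLp_ofReal {g : ℝ → ℝ} (hg : MemLp g ∞ μI) : MemLp (fun x => (g x : ℂ)) 2 μI :=
  (hg.ofReal (K := ℂ)).mono_exponent le_top

end WindowedExp

end

open MeasureTheory
open scoped ENNReal

noncomputable section

namespace WindowedExp

/-! Let P project onto the closed span of e_n, n < 0. The operator S = (1 - P) + gP carries e_n to
φ_n. It is block triangular for P, with diagonal blocks 1 and the self-adjoint Toeplitz operator T =
PgP on the range of P, and S* restricts to T there. So a lower frame bound makes T bounded below,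
and this in turn makes T and S invertible, which gives a Riesz basis.

If Tv is 0 or e_{-1}, then gv is orthogonal to e_n v for all n < 0. The real function g|v|² then has
no nonzero frequency, hence is constant (`ae_mul_norm_sq_eq_integral`). Also v ≠ 0 a.e. unless v = 0
(`ae_ne_zero_of_mem_negFreq`, an F. and M. Riesz type theorem). With Tv = 0 the constant is 0, which
forces g = 0 a.e. and proves completeness. With Tv = e_{-1}, g has constant sign. Applied to g - t
for small t, this opens a gap around 0, so g is bounded away from 0 on one side. Conversely, such a
g makes the quadratic form ∫ g|v|² of T definite. -/

/-! ### Exponentials and uniqueness of Fourier coefficients -/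

theorem conj_e (n : ℤ) (x : ℝ) : (starRingEnd ℂ) (e n x) = e (-n) x := by
  simp only [e, ← Complex.exp_conj]
  congr 1
  simp [Complex.conj_ofNat]

theorem e_mul_e (m n : ℤ) (x : ℝ) : e m x * e n x = e (m + n) x := by
  simp only [e, ← Complex.exp_add]
  congr 1
  push_cast
  ring

theorem e_zero (x : ℝ) : e 0 x = 1 := by simp [e]

theorem integral_e (n : ℤ) : ∫ x, e n x ∂μI = if n = 0 then 1 else 0 := by
  rw [integral_Icc_eq_integral_Ioc, ← intervalIntegral.integral_of_le (by norm_num)]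
  split_ifs with hn
  · subst hn
    simp only [e_zero, intervalIntegral.integral_const]
    norm_num
  · have hc : (2 * Real.pi * Complex.I * n : ℂ) ≠ 0 := by
      simp [Real.pi_ne_zero, hn]
    simp only [e]
    rw [integral_exp_mul_complex hc, div_eq_zero_iff]
    left
    rw [sub_eq_zero]
    have : (2 * Real.pi * Complex.I * n * ((1 / 2 : ℝ) : ℂ)) =
        2 * Real.pi * Complex.I * n * ((-1 / 2 : ℝ) : ℂ) + n * (2 * Real.pi * Complex.I) := by
      push_cast; ring
    rw [this, Complex.exp_periodic.int_mul n]

instance : Fact ((0 : ℝ) < 1) := ⟨one_pos⟩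

/-- An integrable function on `[-1/2, 1/2]` with vanishing Fourier coefficients is zero. -/
theorem ae_eq_zero_of_integral_mul_e_eq_zero {f : ℝ → ℂ} (hf : Integrable f μI)
    (h : ∀ n : ℤ, ∫ x, f x * e n x ∂μI = 0) : f =ᵐ[μI] 0 := by
  have hψi (ψ : C(AddCircle (1 : ℝ), ℂ)) :
      Integrable (fun x : ℝ => f x * ψ (x : AddCircle (1 : ℝ))) μI := by
    refine hf.mul_bdd (c := ‖ψ‖) ?_ (ae_of_all _ fun x => ψ.norm_coe_le_norm _)
    exact (ψ.continuous.comp (AddCircle.continuous_mk' 1)).aestronglyMeasurable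
  let Λ : C(AddCircle (1 : ℝ), ℂ) →L[ℂ] ℂ := LinearMap.mkContinuous
    { toFun := fun ψ => ∫ x : ℝ, f x * ψ (x : AddCircle (1 : ℝ)) ∂μI
      map_add' := fun ψ χ => by
        simp only [ContinuousMap.add_apply, mul_add]
        exact integral_add (hψi ψ) (hψi χ)
      map_smul' := fun c ψ => by
        simp only [ContinuousMap.smul_apply, smul_eq_mul, RingHom.id_apply,
          ← integral_const_mul]
        exact integral_congr_ae (ae_of_all _ fun x => by ring) }
    (∫ x, ‖f x‖ ∂μI) (fun ψ => by
      rw [← integral_mul_const]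
      refine norm_integral_le_of_norm_le (hf.norm.mul_const _) (ae_of_all _ fun x => ?_)
      rw [norm_mul]
      exact mul_le_mul_of_nonneg_left (ψ.norm_coe_le_norm _) (norm_nonneg _))
  -- Trigonometric polynomials are dense in C(circle), and Λ is sup-norm continuous.
  have hΛ (ψ : C(AddCircle (1 : ℝ), ℂ)) :
      ∫ x : ℝ, f x * ψ (x : AddCircle (1 : ℝ)) ∂μI = 0 := by
    have hker : (⊤ : Submodule ℂ C(AddCircle (1 : ℝ), ℂ)) ≤ Λ.ker := by
      rw [← span_fourier_closure_eq_top]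
      refine Submodule.topologicalClosure_minimal _ ?_ Λ.isClosed_ker
      rw [Submodule.span_le]
      rintro _ ⟨n, rfl⟩
      change ∫ x : ℝ, f x * fourier n (x : AddCircle (1 : ℝ)) ∂μI = 0
      rw [← h n]
      refine integral_congr_ae (ae_of_all _ fun x => ?_)
      simp [e]
    exact hker (Submodule.mem_top (x := ψ))
  have hU : ∀ᵐ x ∂μI, x ∈ Set.Ioo (-1 / 2 : ℝ) (1 / 2) → f x = 0 := by
    refine isOpen_Ioo.ae_eq_zero_of_integral_contDiff_smul_eq_zero
      (hf.locallyIntegrable.locallyIntegrableOn _) fun φ hφ _ hsupp => ?_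
    have hz (x : ℝ) (hx : x ∉ Set.Ioo (-1 / 2 : ℝ) (1 / 2)) : φ x = 0 :=
      image_eq_zero_of_notMem_tsupport fun hx' => hx (hsupp hx')
    have hφc : Continuous fun x => (φ x : ℂ) := Complex.continuous_ofReal.comp hφ.continuous
    -- A test function supported in the open interval vanishes at both endpoints, so it glues to a
    -- continuous function on the circle.
    let ψ : C(AddCircle (1 : ℝ), ℂ) :=
      ⟨AddCircle.liftIco 1 (-1 / 2) fun x => (φ x : ℂ), AddCircle.liftIco_continuous
        (by rw [hz (-1 / 2) (by simp), hz (-1 / 2 + 1) (by norm_num)]) hφc.continuousOn⟩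
    rw [← hΛ ψ]
    refine integral_congr_ae ?_
    have hne : ∀ᵐ x ∂μI, x ≠ (1 / 2 : ℝ) := ae_restrict_of_ae (Measure.ae_ne volume _)
    filter_upwards [hne, ae_restrict_mem measurableSet_Icc] with x hx hx'
    have hmem : x ∈ Set.Ico (-1 / 2 : ℝ) (-1 / 2 + 1) :=
      ⟨hx'.1, by linarith [lt_of_le_of_ne hx'.2 hx]⟩
    have : ψ (x : AddCircle (1 : ℝ)) = φ x :=
      AddCircle.liftIco_coe_apply (f := fun x => (φ x : ℂ)) hmem
    rw [this, mul_comm, Complex.real_smul]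
  have h1 : ∀ᵐ x ∂μI, x ≠ (1 / 2 : ℝ) := ae_restrict_of_ae (Measure.ae_ne volume _)
  have h2 : ∀ᵐ x ∂μI, x ≠ (-1 / 2 : ℝ) := ae_restrict_of_ae (Measure.ae_ne volume _)
  filter_upwards [hU, h1, h2, ae_restrict_mem measurableSet_Icc] with x hx h1 h2 h3
  exact hx ⟨lt_of_le_of_ne h3.1 h2.symm, lt_of_le_of_ne h3.2 h1⟩

/-! ### Multiplication operators and the exponential basis -/

theorem memLp_mul_coeFn {h : ℝ → ℂ} (hh : MemLp h ∞ μI) (f : Lp ℂ 2 μI) :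
    MemLp (fun x => h x * f x) 2 μI :=
  (Lp.memLp f).mul (r := 2) hh

/-- Multiplication by an essentially bounded function on `L²[-1/2, 1/2]`. -/
def mulOp (h : ℝ → ℂ) (hh : MemLp h ∞ μI) : Lp ℂ 2 μI →L[ℂ] Lp ℂ 2 μI :=
  LinearMap.mkContinuous
    { toFun := fun f => (memLp_mul_coeFn hh f).toLp fun x => h x * f x
      map_add' := fun f g => by
        rw [← MemLp.toLp_add]
        refine MemLp.toLp_congr _ _ ?_
        filter_upwards [Lp.coeFn_add f g] with x hx
        simp only [hx, Pi.add_apply, mul_add]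
      map_smul' := fun c f => by
        rw [RingHom.id_apply, ← MemLp.toLp_const_smul]
        refine MemLp.toLp_congr _ _ ?_
        filter_upwards [Lp.coeFn_smul c f] with x hx
        simp only [hx, Pi.smul_apply, smul_eq_mul]
        ring }
    (eLpNorm h ∞ μI).toReal (fun f => by
      refine Lp.norm_le_mul_norm_of_ae_le_mul ?_
      filter_upwards [MemLp.coeFn_toLp (memLp_mul_coeFn hh f),
        ae_le_eLpNormEssSup (f := h) (μ := μI)] with x h1 h2
      have h3 : ‖h x‖ ≤ (eLpNorm h ∞ μI).toReal := by
        rw [← toReal_enorm]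
        refine ENNReal.toReal_mono hh.2.ne ?_
        rwa [eLpNorm_exponent_top]
      simp only [LinearMap.coe_mk, AddHom.coe_mk, h1, norm_mul]
      exact mul_le_mul_of_nonneg_right h3 (norm_nonneg _))

theorem coeFn_mulOp (h : ℝ → ℂ) (hh : MemLp h ∞ μI) (f : Lp ℂ 2 μI) :
    mulOp h hh f =ᵐ[μI] fun x => h x * f x :=
  MemLp.coeFn_toLp (memLp_mul_coeFn hh f)

theorem norm_mulOp_apply_le {h : ℝ → ℂ} (hh : MemLp h ∞ μI) {C : ℝ}
    (hC : ∀ᵐ x ∂μI, ‖h x‖ ≤ C) (f : Lp ℂ 2 μI) : ‖mulOp h hh f‖ ≤ C * ‖f‖ := by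
  refine Lp.norm_le_mul_norm_of_ae_le_mul ?_
  filter_upwards [coeFn_mulOp h hh f, hC] with x h1 h2
  rw [h1, norm_mul]
  exact mul_le_mul_of_nonneg_right h2 (norm_nonneg _)

theorem inner_eq_integral (f g : Lp ℂ 2 μI) :
    inner ℂ f g = ∫ x, (starRingEnd ℂ) (f x) * g x ∂μI := by
  rw [L2.inner_def]
  simp only [RCLike.inner_apply']

/-- The exponential `e n` as an element of `L²[-1/2, 1/2]`. -/
def expLp (n : ℤ) : Lp ℂ 2 μI := (memLp_e n 2).toLp (e n)

theorem coeFn_expLp (n : ℤ) : expLp n =ᵐ[μI] e n := MemLp.coeFn_toLp _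

/-- Multiplication by the exponential `e n` on `L²[-1/2, 1/2]`. -/
def modulation (n : ℤ) : Lp ℂ 2 μI →L[ℂ] Lp ℂ 2 μI := mulOp (e n) (memLp_e n ∞)

theorem coeFn_modulation (n : ℤ) (f : Lp ℂ 2 μI) :
    modulation n f =ᵐ[μI] fun x => e n x * f x := coeFn_mulOp _ _ _

theorem modulation_expLp (m n : ℤ) : modulation m (expLp n) = expLp (m + n) := by
  ext1
  filter_upwards [coeFn_modulation m (expLp n), coeFn_expLp n, coeFn_expLp (m + n)]
    with x h1 h2 h3
  rw [h1, h2, h3, e_mul_e]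

theorem modulation_modulation (m n : ℤ) (f : Lp ℂ 2 μI) :
    modulation m (modulation n f) = modulation (m + n) f := by
  ext1
  filter_upwards [coeFn_modulation m (modulation n f), coeFn_modulation n f,
    coeFn_modulation (m + n) f] with x h1 h2 h3
  rw [h1, h2, h3, ← e_mul_e, mul_assoc]

theorem inner_modulation_left (n : ℤ) (f g : Lp ℂ 2 μI) :
    inner ℂ (modulation n f) g = inner ℂ f (modulation (-n) g) := by
  rw [inner_eq_integral, inner_eq_integral]
  refine integral_congr_ae ?_
  filter_upwards [coeFn_modulation n f, coeFn_modulation (-n) g] with x h1 h2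
  rw [h1, h2, map_mul, conj_e]
  ring

theorem inner_expLp_modulation (m n : ℤ) (f : Lp ℂ 2 μI) :
    inner ℂ (expLp m) (modulation n f) = inner ℂ (expLp (m - n)) f := by
  have := inner_modulation_left (-n) (expLp m) f
  rw [neg_neg] at this
  rw [← this, modulation_expLp, neg_add_eq_sub]

theorem inner_expLp (n : ℤ) (f : Lp ℂ 2 μI) :
    inner ℂ (expLp n) f = ∫ x, f x * e (-n) x ∂μI := by
  rw [inner_eq_integral]
  refine integral_congr_ae ?_
  filter_upwards [coeFn_expLp n] with x h1
  rw [h1, conj_e, mul_comm]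

theorem orthonormal_expLp : Orthonormal ℂ expLp := by
  rw [orthonormal_iff_ite]
  intro m n
  rw [inner_expLp]
  have : ∫ x, (expLp n) x * e (-m) x ∂μI = ∫ x, e (n - m) x ∂μI := by
    refine integral_congr_ae ?_
    filter_upwards [coeFn_expLp n] with x h1
    rw [h1, e_mul_e, sub_eq_add_neg]
  rw [this, integral_e]
  exact if_congr (by rw [sub_eq_zero, eq_comm]) rfl rfl

theorem integrable_coeFn (f : Lp ℂ 2 μI) : Integrable f μI :=
  (Lp.memLp f).integrable (by norm_num)

theorem eq_zero_of_inner_expLp_eq_zero {f : Lp ℂ 2 μI}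
    (h : ∀ n : ℤ, inner ℂ (expLp n) f = 0) : f = 0 := by
  rw [Lp.eq_zero_iff_ae_eq_zero]
  refine ae_eq_zero_of_integral_mul_e_eq_zero (integrable_coeFn f) fun n => ?_
  have := h (-n)
  rwa [inner_expLp, neg_neg] at this

/-- The exponentials form a Hilbert basis of `L²[-1/2, 1/2]`. -/
def expBasis : HilbertBasis ℤ ℂ (Lp ℂ 2 μI) :=
  HilbertBasis.mkOfOrthogonalEqBot orthonormal_expLp (by
    rw [Submodule.eq_bot_iff]
    intro f hf
    refine eq_zero_of_inner_expLp_eq_zero fun n => ?_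
    exact (Submodule.mem_orthogonal _ _).1 hf _ (Submodule.subset_span ⟨n, rfl⟩))

theorem coe_expBasis : ⇑expBasis = expLp := HilbertBasis.coe_mkOfOrthogonalEqBot _ _

/-- Multiplication by a real-valued essentially bounded function on `L²[-1/2, 1/2]`. -/
def realMulOp (r : ℝ → ℝ) (hr : MemLp r ∞ μI) : Lp ℂ 2 μI →L[ℂ] Lp ℂ 2 μI :=
  mulOp (fun x => (r x : ℂ)) (hr.ofReal (K := ℂ))

theorem coeFn_realMulOp {r : ℝ → ℝ} (hr : MemLp r ∞ μI) (f : Lp ℂ 2 μI) :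
    realMulOp r hr f =ᵐ[μI] fun x => (r x : ℂ) * f x := coeFn_mulOp _ _ _

theorem inner_realMulOp_left {r : ℝ → ℝ} (hr : MemLp r ∞ μI) (f g : Lp ℂ 2 μI) :
    inner ℂ (realMulOp r hr f) g = inner ℂ f (realMulOp r hr g) := by
  rw [inner_eq_integral, inner_eq_integral]
  refine integral_congr_ae ?_
  filter_upwards [coeFn_realMulOp hr f, coeFn_realMulOp hr g] with x h1 h2
  rw [h1, h2, map_mul, Complex.conj_ofReal]
  ring

theorem integrable_norm_sq (f : Lp ℂ 2 μI) : Integrable (fun x => ‖f x‖ ^ 2) μI :=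
  (Lp.memLp f).integrable_norm_pow (by norm_num)

theorem integral_norm_sq (f : Lp ℂ 2 μI) : ∫ x, ‖f x‖ ^ 2 ∂μI = ‖f‖ ^ 2 := by
  have h : inner ℂ f f = ((∫ x, ‖f x‖ ^ 2 ∂μI : ℝ) : ℂ) := by
    rw [inner_eq_integral, ← integral_complex_ofReal]
    refine integral_congr_ae (ae_of_all _ fun x => ?_)
    simp [Complex.conj_mul']
  rw [inner_self_eq_norm_sq_to_K] at h
  have h' : (‖f‖ : ℂ) ^ 2 = ((∫ x, ‖f x‖ ^ 2 ∂μI : ℝ) : ℂ) := h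
  exact_mod_cast h'.symm

theorem integrable_mul_norm_sq {r : ℝ → ℝ} (hr : MemLp r ∞ μI) (f : Lp ℂ 2 μI) :
    Integrable (fun x => r x * ‖f x‖ ^ 2) μI :=
  memLp_one_iff_integrable.1 ((memLp_one_iff_integrable.2 (integrable_norm_sq f)).mul (r := 1) hr)

theorem inner_modulation_realMulOp {r : ℝ → ℝ} (hr : MemLp r ∞ μI) (n : ℤ) (f : Lp ℂ 2 μI) :
    inner ℂ (modulation n f) (realMulOp r hr f) =
      ∫ x, ((r x * ‖f x‖ ^ 2 : ℝ) : ℂ) * e (-n) x ∂μI := by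
  rw [inner_eq_integral]
  refine integral_congr_ae ?_
  filter_upwards [coeFn_realMulOp hr f, coeFn_modulation n f] with x h1 h2
  rw [h1, h2, map_mul, conj_e, Complex.ofReal_mul, Complex.ofReal_pow, ← Complex.conj_mul']
  ring

theorem inner_self_realMulOp {r : ℝ → ℝ} (hr : MemLp r ∞ μI) (f : Lp ℂ 2 μI) :
    inner ℂ f (realMulOp r hr f) = ((∫ x, r x * ‖f x‖ ^ 2 ∂μI : ℝ) : ℂ) := by
  rw [inner_eq_integral, ← integral_complex_ofReal]
  refine integral_congr_ae ?_
  filter_upwards [coeFn_realMulOp hr f] with x h1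
  rw [h1]
  simp only [Complex.ofReal_mul, Complex.ofReal_pow, ← Complex.conj_mul']
  ring

/-- A real density `r |f|²` all of whose Fourier coefficients on one side vanish is constant. -/
theorem ae_mul_norm_sq_eq_integral {r : ℝ → ℝ} (hr : MemLp r ∞ μI) (f : Lp ℂ 2 μI)
    (h : ∀ n : ℤ, n < 0 → inner ℂ (modulation n f) (realMulOp r hr f) = 0) :
    ∀ᵐ x ∂μI, r x * ‖f x‖ ^ 2 = ∫ y, r y * ‖f y‖ ^ 2 ∂μI := by
  set κ : ℝ := ∫ y, r y * ‖f y‖ ^ 2 ∂μI with hκ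
  set d : ℝ → ℝ := fun x => r x * ‖f x‖ ^ 2 with hd
  have hdi : Integrable (fun x => (d x : ℂ)) μI := (integrable_mul_norm_sq hr f).ofReal
  have hpos (n : ℤ) (hn : 0 < n) : ∫ x, (d x : ℂ) * e n x ∂μI = 0 := by
    have := h (-n) (by lia)
    rwa [inner_modulation_realMulOp, neg_neg] at this
  -- The density is real, so opposite coefficients are conjugate.
  have hneg (n : ℤ) (hn : n < 0) : ∫ x, (d x : ℂ) * e n x ∂μI = 0 := by
    have h1 := congrArg (starRingEnd ℂ) (hpos (-n) (by lia))
    rw [← integral_conj, map_zero] at h1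
    rw [← h1]
    refine integral_congr_ae (ae_of_all _ fun x => ?_)
    simp [conj_e]
  have hzero : (fun x => (d x : ℂ) - κ) =ᵐ[μI] 0 := by
    refine ae_eq_zero_of_integral_mul_e_eq_zero (hdi.sub (integrable_const _)) fun n => ?_
    have hb (F : ℝ → ℂ) (hF : Integrable F μI) : Integrable (fun x => F x * e n x) μI :=
      hF.mul_bdd (c := 1) (continuous_e n).aestronglyMeasurable
        (ae_of_all _ fun x => (norm_e n x).le)
    simp only [sub_mul]
    rw [integral_sub (hb _ hdi) (hb _ (integrable_const _)), integral_const_mul, integral_e]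
    rcases lt_trichotomy n 0 with hn | hn | hn
    · rw [hneg n hn, if_neg hn.ne, mul_zero, sub_zero]
    · subst hn
      simp only [e_zero, mul_one, if_true]
      rw [integral_complex_ofReal, sub_self]
    · rw [hpos n hn, if_neg hn.ne', mul_zero, sub_zero]
  filter_upwards [hzero] with x hx
  have : (d x : ℂ) = κ := sub_eq_zero.1 hx
  exact_mod_cast this

/-! ### Functions with negative frequencies -/

/-- The functions in `L²[-1/2, 1/2]` all of whose frequencies are negative. -/
def negFreq : Submodule ℂ (Lp ℂ 2 μI) :=
  (Submodule.span ℂ (expLp '' {n | 0 ≤ n}))ᗮ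

instance : CompleteSpace negFreq :=
  inferInstanceAs (CompleteSpace (Submodule.span ℂ (expLp '' {n | 0 ≤ n}))ᗮ)

theorem mem_negFreq {f : Lp ℂ 2 μI} :
    f ∈ negFreq ↔ ∀ n : ℤ, 0 ≤ n → inner ℂ (expLp n) f = 0 := by
  constructor
  · intro hf n hn
    exact (Submodule.mem_orthogonal _ _).1 hf _ (Submodule.subset_span ⟨n, hn, rfl⟩)
  · intro h
    have : Submodule.span ℂ (expLp '' {n | 0 ≤ n}) ≤ (ℂ ∙ f)ᗮ := by
      rw [Submodule.span_le]
      rintro _ ⟨n, hn, rfl⟩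
      rw [SetLike.mem_coe, Submodule.mem_orthogonal_singleton_iff_inner_left]
      exact h n hn
    exact Submodule.orthogonal_le this
      (Submodule.le_orthogonal_orthogonal _ (Submodule.mem_span_singleton_self f))

theorem modulation_mem_negFreq {f : Lp ℂ 2 μI} (hf : f ∈ negFreq) {n : ℤ} (hn : n ≤ 0) :
    modulation n f ∈ negFreq := by
  rw [mem_negFreq] at hf ⊢
  intro m hm
  rw [inner_expLp_modulation]
  exact hf _ (by lia)

theorem expLp_mem_negFreq {n : ℤ} (hn : n < 0) : expLp n ∈ negFreq := by
  rw [mem_negFreq]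
  intro m hm
  exact orthonormal_expLp.2 (by lia)

theorem expLp_mem_orthogonal_negFreq {n : ℤ} (hn : 0 ≤ n) : expLp n ∈ negFreqᗮ :=
  Submodule.le_orthogonal_orthogonal _ (Submodule.subset_span ⟨n, hn, rfl⟩)

theorem exists_isGreatest_frequency {f : Lp ℂ 2 μI} (hf : f ∈ negFreq) (hf0 : f ≠ 0) :
    ∃ m : ℤ, inner ℂ (expLp m) f ≠ 0 ∧ ∀ n : ℤ, m < n → inner ℂ (expLp n) f = 0 := by
  have hex : ∃ m : ℤ, inner ℂ (expLp m) f ≠ 0 := by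
    by_contra! h
    exact hf0 (eq_zero_of_inner_expLp_eq_zero h)
  obtain ⟨m, hm, hmax⟩ := Int.exists_greatest_of_bdd
    (P := fun m => inner ℂ (expLp m) f ≠ 0)
    ⟨0, fun z hz => by
      by_contra! hz'
      exact hz (mem_negFreq.1 hf z hz'.le)⟩ hex
  refine ⟨m, hm, fun n hn => ?_⟩
  by_contra h
  exact absurd (hmax n h) (by lia)

/-- A nonzero function with only negative frequencies is nonzero almost everywhere. -/
theorem ae_ne_zero_of_mem_negFreq {f : Lp ℂ 2 μI} (hf : f ∈ negFreq) (hf0 : f ≠ 0) :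
    ∀ᵐ x ∂μI, f x ≠ 0 := by
  obtain ⟨m, hm, hmax⟩ := exists_isGreatest_frequency hf hf0
  -- N plays the role of the strict past of f; the innovation u = f - P_N f will have constant
  -- modulus.
  set N : Submodule ℂ (Lp ℂ 2 μI) :=
    (Submodule.span ℂ ((fun n : ℤ => modulation n f) '' {n | n < 0})).topologicalClosure with hN
  have hNcl : IsClosed (N : Set (Lp ℂ 2 μI)) := Submodule.isClosed_topologicalClosure _
  have : CompleteSpace N := hNcl.completeSpace_coe
  have hN_le {M : Submodule ℂ (Lp ℂ 2 μI)} (hM : IsClosed (M : Set (Lp ℂ 2 μI)))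
      (h : ∀ n : ℤ, n < 0 → modulation n f ∈ M) : N ≤ M := by
    refine Submodule.topologicalClosure_minimal _ ?_ hM
    rw [Submodule.span_le]
    rintro _ ⟨n, hn, rfl⟩
    exact h n hn
  have hmemN (n : ℤ) (hn : n < 0) : modulation n f ∈ N :=
    Submodule.le_topologicalClosure _ (Submodule.subset_span ⟨n, hn, rfl⟩)
  have hinv (k : ℤ) (hk : k < 0) : N ≤ N.comap (modulation k).toLinearMap := by
    refine hN_le (hNcl.preimage (modulation k).continuous) fun n hn => ?_
    rw [Submodule.mem_comap, ContinuousLinearMap.coe_coe, modulation_modulation]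
    exact hmemN _ (by lia)
  set u := f - N.starProjection f with hu
  have hu_orth : u ∈ Nᗮ := N.sub_starProjection_mem_orthogonal f
  have hproj : N.starProjection f ∈ N := N.starProjection_apply_mem f
  -- Elements of N have no frequency m, since every e_n f with n < 0 has only frequencies below m;
  -- but f does.
  have hu0 : u ≠ 0 := by
    intro h0
    have hle : N ≤ (innerSL ℂ (expLp m)).ker := by
      refine hN_le (innerSL ℂ (expLp m)).isClosed_ker fun n hn => ?_
      rw [LinearMap.mem_ker, ContinuousLinearMap.coe_coe, innerSL_apply_apply,
        inner_expLp_modulation]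
      exact hmax _ (by lia)
    have h1 := LinearMap.mem_ker.1 (hle hproj)
    rw [ContinuousLinearMap.coe_coe, innerSL_apply_apply, ← sub_eq_zero.1 h0] at h1
    exact hm h1
  have hone : MemLp (fun _ : ℝ => (1 : ℝ)) ∞ μI := memLp_const 1
  have hmul (w : Lp ℂ 2 μI) : realMulOp (fun _ => 1) hone w = w := by
    ext1
    filter_upwards [coeFn_realMulOp hone w] with x hx
    rw [hx, Complex.ofReal_one, one_mul]
  -- For n < 0, e_n u lies in N while u is orthogonal to N, so |u|² is constant.
  have hconst := ae_mul_norm_sq_eq_integral hone u fun n hn => by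
    rw [hmul]
    refine (Submodule.mem_orthogonal _ _).1 hu_orth _ ?_
    rw [hu, map_sub]
    exact N.sub_mem (hmemN n hn) (hinv n hn hproj)
  simp only [one_mul, integral_norm_sq] at hconst
  obtain ⟨s, hs, hfs⟩ : ∃ s : Set ℝ, MeasurableSet s ∧ s = {x | f x = 0} :=
    ⟨_, (Lp.stronglyMeasurable f).measurable (measurableSet_singleton 0), rfl⟩
  have hχ : MemLp (s.indicator fun _ => (1 : ℝ)) ∞ μI := hone.indicator hs
  -- All of N vanishes where f does, hence so does u; but |u| is a nonzero constant.
  have hker : N ≤ (realMulOp _ hχ).ker := by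
    refine hN_le (realMulOp _ hχ).isClosed_ker fun n _ => ?_
    rw [LinearMap.mem_ker, ContinuousLinearMap.coe_coe, Lp.eq_zero_iff_ae_eq_zero]
    filter_upwards [coeFn_realMulOp hχ (modulation n f), coeFn_modulation n f] with x h1 h2
    rw [h1, h2]
    by_cases hx : x ∈ s
    · have : f x = 0 := by rwa [hfs] at hx
      simp [this]
    · simp [hx]
  have hP := LinearMap.mem_ker.1 (hker hproj)
  rw [ContinuousLinearMap.coe_coe, Lp.eq_zero_iff_ae_eq_zero] at hP
  filter_upwards [hconst, hP, coeFn_realMulOp hχ (N.starProjection f),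
    Lp.coeFn_sub f (N.starProjection f)] with x h1 h2 h3 h4 hx
  have hxs : x ∈ s := by rw [hfs]; exact hx
  rw [h3] at h2
  have h5 : (N.starProjection f) x = 0 := by simpa [hxs] using h2
  have h6 : u x = 0 := by rw [hu, h4, Pi.sub_apply, hx, h5, sub_zero]
  rw [h6, norm_zero, zero_pow two_ne_zero] at h1
  exact hu0 (norm_eq_zero.1 (pow_eq_zero_iff two_ne_zero |>.1 h1.symm))

/-! ### Operators on Hilbert space, frames and Riesz bases -/

section Hilbert

variable {ι H : Type*} [NormedAddCommGroup H] [InnerProductSpace ℂ H] [CompleteSpace H]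

/-- A symmetric operator on a Hilbert space that is bounded below is surjective. -/
theorem surjective_of_symmetric_of_bounded_below (T : H →L[ℂ] H)
    (hT : ∀ x y, inner ℂ (T x) y = inner ℂ x (T y)) {c : ℝ} (hc : 0 < c)
    (hbound : ∀ x, c * ‖x‖ ≤ ‖T x‖) : Function.Surjective T := by
  have hanti : AntilipschitzWith (Real.toNNReal c⁻¹) T := by
    refine T.antilipschitz_of_bound fun x => ?_
    rw [Real.coe_toNNReal _ (inv_nonneg.2 hc.le), inv_mul_eq_div, le_div_iff₀ hc, mul_comm]
    exact hbound x
  have hclosed : IsClosed (T.range : Set H) := by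
    have := hanti.isClosed_range T.uniformContinuous
    rwa [LinearMap.coe_range]
  have : CompleteSpace T.range := hclosed.completeSpace_coe
  have htop : T.range = ⊤ := by
    -- By symmetry the orthogonal complement of the range is the kernel, which is trivial.
    rw [← Submodule.orthogonal_eq_bot_iff, Submodule.eq_bot_iff]
    intro x hx
    have hTx : T x = 0 := by
      rw [← inner_self_eq_zero (𝕜 := ℂ), ← hT]
      exact (Submodule.mem_orthogonal _ _).1 hx _ (LinearMap.mem_range_self _ (T x))
    have h1 := hbound x
    rw [hTx, norm_zero] at h1
    exact norm_le_zero_iff.1 (nonpos_of_mul_nonpos_right h1 hc)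
  exact LinearMap.range_eq_top.1 htop

/-- Parseval for S* f: frame bounds for the image system are norm bounds for S*. -/
theorem hasSum_norm_inner_sq (b : HilbertBasis ι ℂ H) (S : H →L[ℂ] H) (f : H) :
    HasSum (fun i => ‖inner ℂ (S (b i)) f‖ ^ 2) (‖S.adjoint f‖ ^ 2) := by
  have h := b.hasSum_inner_mul_inner (S.adjoint f) (S.adjoint f)
  rw [inner_self_eq_norm_sq_to_K] at h
  have h2 : HasSum (fun i => ((‖inner ℂ (S (b i)) f‖ ^ 2 : ℝ) : ℂ))
      ((‖S.adjoint f‖ ^ 2 : ℝ) : ℂ) := by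
    have h3 (i : ι) : ((‖inner ℂ (S (b i)) f‖ ^ 2 : ℝ) : ℂ) =
        inner ℂ (S.adjoint f) (b i) * inner ℂ (b i) (S.adjoint f) := by
      rw [ContinuousLinearMap.adjoint_inner_right, ContinuousLinearMap.adjoint_inner_left,
        ← inner_conj_symm f, Complex.conj_mul', Complex.ofReal_pow]
    simp only [h3]
    rw [Complex.ofReal_pow]
    exact h
  exact_mod_cast h2

/-- The image of a Hilbert basis under an invertible operator is a Riesz basis. -/
theorem isRieszBasis_of_bijective (b : HilbertBasis ι ℂ H) (S : H →L[ℂ] H)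
    (hS : Function.Bijective S) : IsRieszBasis fun i => S (b i) := by
  let R : H ≃L[ℂ] H := ContinuousLinearEquiv.ofBijective S
    (LinearMap.ker_eq_bot.2 hS.1) (LinearMap.range_eq_top.2 hS.2)
  have hR (x : H) : R x = S x := rfl
  refine ⟨?_, fun f => ?_⟩
  · set L : H →L[ℂ] H := (R.symm : H →L[ℂ] H).adjoint with hL
    have hinv (f : H) : L (S.adjoint f) = f := by
      refine ext_inner_left ℂ fun x => ?_
      rw [hL, ContinuousLinearMap.adjoint_inner_right, ContinuousLinearMap.adjoint_inner_right,
        ContinuousLinearEquiv.coe_coe, ← hR, R.apply_symm_apply]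
    -- L inverts S* on the left. The extra 1 keeps the constant positive when the space is trivial.
    have hpos : 0 < (‖L‖ + 1) ^ 2 := by positivity
    refine ⟨((‖L‖ + 1) ^ 2)⁻¹, max ((‖L‖ + 1) ^ 2)⁻¹ (‖S.adjoint‖ ^ 2), inv_pos.2 hpos,
      le_max_left _ _, fun f => ⟨(hasSum_norm_inner_sq b S f).summable, ?_, ?_⟩⟩
    · rw [(hasSum_norm_inner_sq b S f).tsum_eq, inv_mul_eq_div, div_le_iff₀ hpos, ← mul_pow]
      refine pow_le_pow_left₀ (norm_nonneg _) ?_ 2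
      calc ‖f‖ = ‖L (S.adjoint f)‖ := by rw [hinv]
        _ ≤ ‖L‖ * ‖S.adjoint f‖ := L.le_opNorm _
        _ ≤ ‖S.adjoint f‖ * (‖L‖ + 1) := by nlinarith [norm_nonneg (S.adjoint f)]
    · rw [(hasSum_norm_inner_sq b S f).tsum_eq]
      calc ‖S.adjoint f‖ ^ 2 ≤ (‖S.adjoint‖ * ‖f‖) ^ 2 :=
            pow_le_pow_left₀ (norm_nonneg _) (S.adjoint.le_opNorm f) 2
        _ = ‖S.adjoint‖ ^ 2 * ‖f‖ ^ 2 := mul_pow _ _ _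
        _ ≤ _ := mul_le_mul_of_nonneg_right (le_max_right _ _) (by positivity)
  · refine ⟨fun i => inner ℂ (b i) (R.symm f), ?_, fun c hc => ?_⟩
    · have h := (b.hasSum_repr (R.symm f)).mapL S
      rw [← hR, R.apply_symm_apply] at h
      simpa only [map_smul, b.repr_apply_apply] using h
    · have h := hc.mapL (R.symm : H →L[ℂ] H)
      simp only [map_smul, ← hR, ContinuousLinearEquiv.coe_coe, R.symm_apply_apply] at h
      ext i
      classical
      have h1 := h.mapL (innerSL ℂ (b i))
      simp only [innerSL_apply_apply, inner_smul_right,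
        orthonormal_iff_ite.1 b.orthonormal] at h1
      refine HasSum.unique ?_ h1
      have hc' : (fun j => c j * if i = j then (1 : ℂ) else 0) =
          fun j => if j = i then c i else 0 := by
        ext j
        by_cases hij : j = i
        · subst hij; simp
        · simp [hij, Ne.symm hij]
      rw [hc']
      exact hasSum_ite_eq i (c i)

end Hilbert

/-! ### The Toeplitz operator and the sign of its symbol -/

/-- The compression of multiplication by `r` to the functions with negative frequencies. -/
def toeplitz (r : ℝ → ℝ) (hr : MemLp r ∞ μI) : negFreq →L[ℂ] negFreq :=
  negFreq.orthogonalProjectionOnto ∘L realMulOp r hr ∘L negFreq.subtypeL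

theorem coe_toeplitz {r : ℝ → ℝ} (hr : MemLp r ∞ μI) (v : negFreq) :
    (toeplitz r hr v : Lp ℂ 2 μI) = negFreq.starProjection (realMulOp r hr v) := rfl

theorem inner_toeplitz_right {r : ℝ → ℝ} (hr : MemLp r ∞ μI) (u v : negFreq) :
    inner ℂ u (toeplitz r hr v) = inner ℂ (u : Lp ℂ 2 μI) (realMulOp r hr v) :=
  Submodule.inner_orthogonalProjectionOnto_eq_of_mem_left u _

theorem toeplitz_symmetric {r : ℝ → ℝ} (hr : MemLp r ∞ μI) (u v : negFreq) :
    inner ℂ (toeplitz r hr u) v = inner ℂ u (toeplitz r hr v) := by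
  rw [inner_toeplitz_right, ← inner_realMulOp_left]
  exact Submodule.inner_orthogonalProjectionOnto_eq_of_mem_right v _

/-- If the compression of multiplication by `r` is invertible, then `r` does not change sign. -/
theorem ae_nonneg_or_nonpos_of_toeplitz_bounded_below {r : ℝ → ℝ} (hr : MemLp r ∞ μI) {c : ℝ}
    (hc : 0 < c) (hbound : ∀ v, c * ‖v‖ ≤ ‖toeplitz r hr v‖) :
    (∀ᵐ x ∂μI, 0 ≤ r x) ∨ ∀ᵐ x ∂μI, r x ≤ 0 := by
  have hmem : expLp (-1) ∈ negFreq := expLp_mem_negFreq (by norm_num)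
  obtain ⟨v, hv⟩ := surjective_of_symmetric_of_bounded_below (toeplitz r hr)
    (toeplitz_symmetric hr) hc hbound ⟨expLp (-1), hmem⟩
  have hv0 : (v : Lp ℂ 2 μI) ≠ 0 := by
    intro h0
    rw [Submodule.coe_eq_zero] at h0
    rw [h0, map_zero] at hv
    have h1 := orthonormal_expLp.1 (-1)
    have h2 : expLp (-1) = 0 := (congrArg Subtype.val hv).symm
    rw [h2, norm_zero] at h1
    exact zero_ne_one h1
  have hne := ae_ne_zero_of_mem_negFreq v.2 hv0
  -- For n < 0, e_n v has only frequencies below -1, so it is orthogonal to Tv = e_{-1}.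
  have hconst := ae_mul_norm_sq_eq_integral hr (v : Lp ℂ 2 μI) fun n hn => by
    have h1 := inner_toeplitz_right hr ⟨modulation n v, modulation_mem_negFreq v.2 hn.le⟩ v
    rw [← h1, hv, Submodule.coe_inner, ← inner_conj_symm, inner_expLp_modulation,
      mem_negFreq.1 v.2 _ (by lia), map_zero]
  rcases le_total 0 (∫ y, r y * ‖(v : Lp ℂ 2 μI) y‖ ^ 2 ∂μI) with hκ | hκ
  · left
    filter_upwards [hconst, hne] with x h1 h2
    have h3 : 0 < ‖(v : Lp ℂ 2 μI) x‖ ^ 2 := by positivity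
    exact nonneg_of_mul_nonneg_left (h1 ▸ hκ) h3
  · right
    filter_upwards [hconst, hne] with x h1 h2
    have h3 : 0 < ‖(v : Lp ℂ 2 μI) x‖ ^ 2 := by positivity
    exact nonpos_of_mul_nonpos_left (h1 ▸ hκ) h3

/-- Cauchy–Schwarz applied to ⟨v, Tv⟩ = ∫ r|v|², a form definite with constant c. -/
theorem toeplitz_bounded_below_of_le {r : ℝ → ℝ} (hr : MemLp r ∞ μI) {c : ℝ}
    (h : (∀ᵐ x ∂μI, c ≤ r x) ∨ ∀ᵐ x ∂μI, r x ≤ -c) (v : negFreq) :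
    c * ‖v‖ ≤ ‖toeplitz r hr v‖ := by
  have h1 : c * ‖v‖ ^ 2 ≤ |∫ x, r x * ‖(v : Lp ℂ 2 μI) x‖ ^ 2 ∂μI| := by
    have hi := integrable_mul_norm_sq hr (v : Lp ℂ 2 μI)
    have hn := integrable_norm_sq (v : Lp ℂ 2 μI)
    rw [Submodule.coe_norm, ← integral_norm_sq, ← integral_const_mul]
    rcases h with h | h
    · refine le_trans (integral_mono_ae (hn.const_mul c) hi ?_) (le_abs_self _)
      filter_upwards [h] with x hx
      exact mul_le_mul_of_nonneg_right hx (by positivity)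
    · refine le_trans ?_ (neg_le_abs _)
      rw [← integral_neg]
      refine integral_mono_ae (hn.const_mul c) hi.neg ?_
      filter_upwards [h] with x hx
      have := mul_le_mul_of_nonneg_right hx (sq_nonneg ‖(v : Lp ℂ 2 μI) x‖)
      change c * ‖(v : Lp ℂ 2 μI) x‖ ^ 2 ≤ -(r x * ‖(v : Lp ℂ 2 μI) x‖ ^ 2)
      linarith
  have h2 : |∫ x, r x * ‖(v : Lp ℂ 2 μI) x‖ ^ 2 ∂μI| ≤ ‖v‖ * ‖toeplitz r hr v‖ := by
    rw [← Real.norm_eq_abs, ← Complex.norm_real, ← inner_self_realMulOp hr, ← inner_toeplitz_right]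
    exact norm_inner_le_norm (𝕜 := ℂ) v (toeplitz r hr v)
  rcases (norm_nonneg v).eq_or_lt with h0 | h0
  · rw [← h0, mul_zero]
    exact norm_nonneg _
  · refine le_of_mul_le_mul_left ?_ h0
    calc ‖v‖ * (c * ‖v‖) = c * ‖v‖ ^ 2 := by ring
      _ ≤ _ := h1.trans h2

theorem toeplitz_sub_const {r : ℝ → ℝ} (hr : MemLp r ∞ μI) (t : ℝ)
    (hrt : MemLp (fun x => r x - t) ∞ μI) (v : negFreq) :
    toeplitz (fun x => r x - t) hrt v = toeplitz r hr v - (t : ℂ) • v := by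
  have h : realMulOp (fun x => r x - t) hrt v = realMulOp r hr v - (t : ℂ) • (v : Lp ℂ 2 μI) := by
    ext1
    filter_upwards [coeFn_realMulOp hrt (v : Lp ℂ 2 μI), coeFn_realMulOp hr (v : Lp ℂ 2 μI),
      Lp.coeFn_sub (realMulOp r hr v) ((t : ℂ) • (v : Lp ℂ 2 μI)),
      Lp.coeFn_smul (t : ℂ) (v : Lp ℂ 2 μI)] with x h1 h2 h3 h4
    rw [h1, h3, Pi.sub_apply, h2, h4, Pi.smul_apply, smul_eq_mul, Complex.ofReal_sub, sub_mul]
  ext1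
  rw [coe_toeplitz, h, map_sub, map_smul, Submodule.coe_sub, Submodule.coe_smul, coe_toeplitz,
    Submodule.starProjection_eq_self_iff.2 v.2]

theorem norm_toeplitz_apply_le {r : ℝ → ℝ} (hr : MemLp r ∞ μI) {C : ℝ}
    (hC : ∀ᵐ x ∂μI, |r x| ≤ C) (v : negFreq) : ‖toeplitz r hr v‖ ≤ C * ‖v‖ := by
  refine (negFreq.norm_orthogonalProjectionOnto_apply_le _).trans
    (norm_mulOp_apply_le (hr.ofReal (K := ℂ)) ?_ _)
  filter_upwards [hC] with x hx
  simpa using hx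

/-- If the compression of multiplication by `r` is bounded below, then `r` is bounded away from
zero and has constant sign. -/
theorem exists_ae_le_of_toeplitz_bounded_below {r : ℝ → ℝ} (hr : MemLp r ∞ μI) {c : ℝ}
    (hc : 0 < c) (hbound : ∀ v, c * ‖v‖ ≤ ‖toeplitz r hr v‖) :
    ∃ ε : ℝ, 0 < ε ∧ ((∀ᵐ x ∂μI, ε ≤ r x) ∨ ∀ᵐ x ∂μI, r x ≤ -ε) := by
  have hsign (t : ℝ) (ht : |t| ≤ c / 2) :
      (∀ᵐ x ∂μI, t ≤ r x) ∨ ∀ᵐ x ∂μI, r x ≤ t := by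
    have hrt : MemLp (fun x => r x - t) ∞ μI := hr.sub (memLp_const t)
    -- Shifting by |t| ≤ c/2 costs at most half of the lower bound.
    have := ae_nonneg_or_nonpos_of_toeplitz_bounded_below hrt (half_pos hc) fun v => by
      rw [toeplitz_sub_const hr t hrt]
      have h1 := norm_sub_norm_le (toeplitz r hr v) ((t : ℂ) • v)
      rw [norm_smul, Complex.norm_real, Real.norm_eq_abs] at h1
      nlinarith [hbound v, norm_nonneg v]
    simpa only [sub_nonneg, sub_nonpos] using this
  refine ⟨c / 2, half_pos hc, ?_⟩
  have hc2 : |c / 2| = c / 2 := abs_of_pos (half_pos hc)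
  by_contra hcon
  rw [not_or] at hcon
  have h1 := (hsign (c / 2) hc2.le).resolve_left hcon.1
  have h2 := (hsign (-(c / 2)) (by rw [abs_neg, hc2])).resolve_right hcon.2
  have h3 : ∀ᵐ x ∂μI, |r x| ≤ c / 2 := by
    filter_upwards [h1, h2] with x h1 h2
    exact abs_le.2 ⟨h2, h1⟩
  have hmem : expLp (-1) ∈ negFreq := expLp_mem_negFreq (by norm_num)
  -- If |r| ≤ c/2 a.e., the unit vector e_{-1} would give c ≤ c/2.
  have h4 := (hbound ⟨_, hmem⟩).trans (norm_toeplitz_apply_le hr h3 ⟨_, hmem⟩)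
  rw [Submodule.coe_norm, orthonormal_expLp.1] at h4
  linarith

/-! ### The synthesis operator -/

/-- The operator taking the exponentials to the windowed system. -/
def systemOp (r : ℝ → ℝ) (hr : MemLp r ∞ μI) : Lp ℂ 2 μI →L[ℂ] Lp ℂ 2 μI :=
  1 - negFreq.starProjection + realMulOp r hr ∘L negFreq.starProjection

theorem systemOp_apply {r : ℝ → ℝ} (hr : MemLp r ∞ μI) (f : Lp ℂ 2 μI) :
    systemOp r hr f =
      f - negFreq.starProjection f + realMulOp r hr (negFreq.starProjection f) := rfl

theorem systemOp_expLp {r : ℝ → ℝ} (hr : MemLp r ∞ μI) (n : ℤ) :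
    systemOp r hr (expLp n) = system (fun x => (r x : ℂ)) (memLp_ofReal hr) n := by
  rw [systemOp_apply, system]
  split_ifs with hn
  · rw [negFreq.starProjection_apply_eq_zero_iff.2 (expLp_mem_orthogonal_negFreq hn), map_zero,
      sub_zero, add_zero, expLp]
  · rw [Submodule.starProjection_eq_self_iff.2 (expLp_mem_negFreq (not_le.1 hn)), sub_self,
      zero_add]
    ext1
    filter_upwards [coeFn_realMulOp hr (expLp n), coeFn_expLp n,
      MemLp.coeFn_toLp (memLp_mul_e (memLp_ofReal hr) n)] with x h1 h2 h3
    rw [h1, h2, h3]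

theorem system_eq {r : ℝ → ℝ} (hr : MemLp r ∞ μI) :
    system (fun x => (r x : ℂ)) (memLp_ofReal hr) = fun n => systemOp r hr (expBasis n) := by
  ext1 n
  rw [coe_expBasis, systemOp_expLp]

/-- S* = (1 - P) + P M_r, and 1 - P kills v. -/
theorem systemOp_adjoint_apply {r : ℝ → ℝ} (hr : MemLp r ∞ μI) (v : negFreq) :
    (systemOp r hr).adjoint v = toeplitz r hr v := by
  refine ext_inner_left ℂ fun x => ?_
  have h1 : inner ℂ (x - negFreq.starProjection x) (v : Lp ℂ 2 μI) = 0 :=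
    negFreq.starProjection_inner_eq_zero x v v.2
  rw [ContinuousLinearMap.adjoint_inner_right, systemOp_apply, inner_add_left, h1, zero_add,
    inner_realMulOp_left, coe_toeplitz, Submodule.inner_starProjection_left_eq_right]

/-- Block triangularity: P S = T P, and S fixes the orthogonal complement of `negFreq`. -/
theorem systemOp_bijective {r : ℝ → ℝ} (hr : MemLp r ∞ μI) {c : ℝ} (hc : 0 < c)
    (hbound : ∀ v, c * ‖v‖ ≤ ‖toeplitz r hr v‖) : Function.Bijective (systemOp r hr) := by
  have hQ (f : Lp ℂ 2 μI) :
      negFreq.starProjection (f - negFreq.starProjection f) = 0 :=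
    negFreq.starProjection_apply_eq_zero_iff.2 (negFreq.sub_starProjection_mem_orthogonal f)
  have hQQ (v : negFreq) : negFreq.starProjection (v : Lp ℂ 2 μI) = v :=
    Submodule.starProjection_eq_self_iff.2 v.2
  constructor
  · rw [injective_iff_map_eq_zero]
    intro f hf
    set v : negFreq := negFreq.orthogonalProjectionOnto f with hv
    have hvf : negFreq.starProjection f = v := rfl
    have h1 : toeplitz r hr v = 0 := by
      ext1
      have := congrArg negFreq.starProjection hf
      rwa [systemOp_apply, map_add, hQ, zero_add, map_zero, hvf, ← coe_toeplitz] at this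
    have h2 := hbound v
    rw [h1, norm_zero] at h2
    have h3 : v = 0 := norm_le_zero_iff.1 (nonpos_of_mul_nonpos_right h2 hc)
    rw [systemOp_apply, hvf, h3] at hf
    simpa using hf
  · intro f
    obtain ⟨v, hv⟩ := surjective_of_symmetric_of_bounded_below (toeplitz r hr)
      (toeplitz_symmetric hr) hc hbound (negFreq.orthogonalProjectionOnto f)
    have hv' : negFreq.starProjection (realMulOp r hr v) = negFreq.starProjection f :=
      congrArg Subtype.val hv
    -- As P(rv) = Pf, the part f - rv is fixed by S, while v goes to rv.
    refine ⟨f - realMulOp r hr v + v, ?_⟩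
    have h1 : negFreq.starProjection (f - realMulOp r hr v + v) = v := by
      rw [map_add, map_sub, hv', sub_self, zero_add, hQQ]
    rw [systemOp_apply, h1]
    abel

/-! ### Completeness, the frame bound and the essential range -/

theorem isCompleteSystem_system {r : ℝ → ℝ} (hr : MemLp r ∞ μI) (hr0 : ¬ r =ᵐ[μI] 0) :
    IsCompleteSystem (system (fun x => (r x : ℂ)) (memLp_ofReal hr)) := by
  intro f hf
  have hmem : f ∈ negFreq := mem_negFreq.2 fun n hn => by
    have h1 := hf n
    rwa [system, if_pos hn] at h1
  have hT : toeplitz r hr ⟨f, hmem⟩ = 0 := by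
    ext1
    rw [← systemOp_adjoint_apply]
    refine eq_zero_of_inner_expLp_eq_zero fun n => ?_
    rw [ContinuousLinearMap.adjoint_inner_right, systemOp_expLp]
    exact hf n
  have horth (n : ℤ) (hn : n ≤ 0) : inner ℂ (modulation n f) (realMulOp r hr f) = 0 := by
    have h1 := inner_toeplitz_right hr ⟨_, modulation_mem_negFreq hmem hn⟩ ⟨f, hmem⟩
    rw [hT, inner_zero_right] at h1
    exact h1.symm
  by_contra hf0
  have hconst := ae_mul_norm_sq_eq_integral hr f fun n hn => horth n hn.le
  have hκ : ∫ y, r y * ‖f y‖ ^ 2 ∂μI = 0 := by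
    have h1 := inner_toeplitz_right hr ⟨f, hmem⟩ ⟨f, hmem⟩
    rw [hT, inner_zero_right, inner_self_realMulOp] at h1
    exact_mod_cast h1.symm
  refine hr0 ?_
  filter_upwards [hconst, ae_ne_zero_of_mem_negFreq hmem hf0] with x h1 h2
  rw [hκ] at h1
  exact (mul_eq_zero.1 h1).resolve_right (by positivity)

theorem toeplitz_bounded_below_of_isFrame {r : ℝ → ℝ} (hr : MemLp r ∞ μI)
    (h : IsFrame (system (fun x => (r x : ℂ)) (memLp_ofReal hr))) :
    ∃ c : ℝ, 0 < c ∧ ∀ v, c * ‖v‖ ≤ ‖toeplitz r hr v‖ := by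
  obtain ⟨A, B, hA, -, hAB⟩ := h
  refine ⟨√A, Real.sqrt_pos.2 hA, fun v => ?_⟩
  have h1 := (hAB v).2.1
  rw [system_eq hr, (hasSum_norm_inner_sq expBasis (systemOp r hr) v).tsum_eq,
    systemOp_adjoint_apply] at h1
  refine le_of_sq_le_sq ?_ (norm_nonneg _)
  rw [mul_pow, Real.sq_sqrt hA.le]
  exact h1

instance : NeZero μI := ⟨by norm_num [Measure.restrict_eq_zero]⟩

/-- Essential boundedness of r is what makes the real-valued `essInf` and `essSup` genuine bounds
rather than default values. -/
theorem zero_notMem_Icc_essInf_essSup_iff {r : ℝ → ℝ} (hr : MemLp r ∞ μI) :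
    (0 : ℝ) ∉ Set.Icc (essInf r μI) (essSup r μI) ↔
      ∃ ε : ℝ, 0 < ε ∧ ((∀ᵐ x ∂μI, ε ≤ r x) ∨ ∀ᵐ x ∂μI, r x ≤ -ε) := by
  obtain ⟨C, hC⟩ : ∃ C : ℝ, ∀ᵐ x ∂μI, |r x| ≤ C := by
    refine ⟨(eLpNorm r ∞ μI).toReal, ?_⟩
    filter_upwards [ae_le_eLpNormEssSup (f := r) (μ := μI)] with x hx
    rw [← Real.norm_eq_abs, ← toReal_enorm]
    refine ENNReal.toReal_mono hr.2.ne ?_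
    rwa [eLpNorm_exponent_top]
  have hle : Filter.IsBoundedUnder (· ≤ ·) (ae μI) r :=
    Filter.isBoundedUnder_of_eventually_le (hC.mono fun x hx => (abs_le.1 hx).2)
  have hge : Filter.IsBoundedUnder (· ≥ ·) (ae μI) r :=
    Filter.isBoundedUnder_of_eventually_ge (hC.mono fun x hx => (abs_le.1 hx).1)
  rw [Set.mem_Icc, not_and_or, not_le, not_le]
  constructor
  · rintro (h | h)
    · exact ⟨_, h, Or.inl (ae_essInf_le hge)⟩
    · refine ⟨_, neg_pos.2 h, Or.inr ?_⟩
      simpa only [neg_neg] using ae_le_essSup hle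
  · rintro ⟨ε, hε, h | h⟩
    · exact Or.inl (hε.trans_le (le_essInf_of_ae_le ε h hle.isCoboundedUnder_ge))
    · exact Or.inr ((essSup_le_of_ae_le (-ε) h hge.isCoboundedUnder_le).trans_lt (neg_lt_zero.2 hε))

end WindowedExp

end

theorem mainTheorem3 (g : ℝ → ℝ) (hg : MemLp g ∞ WindowedExp.μI)
    (hg0 : ¬ g =ᵐ[WindowedExp.μI] 0) :
    WindowedExp.IsCompleteSystem
      (WindowedExp.system (fun x => (g x : ℂ)) (WindowedExp.memLp_ofReal hg)) ∧
    List.TFAE [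
      WindowedExp.IsRieszBasis
        (WindowedExp.system (fun x => (g x : ℂ)) (WindowedExp.memLp_ofReal hg)),
      WindowedExp.IsFrame
        (WindowedExp.system (fun x => (g x : ℂ)) (WindowedExp.memLp_ofReal hg)),
      (0 : ℝ) ∉ Set.Icc (essInf g WindowedExp.μI) (essSup g WindowedExp.μI)] := by
  refine ⟨WindowedExp.isCompleteSystem_system hg hg0, ?_⟩
  tfae_have 1 → 2 := And.left
  tfae_have 2 → 3 := by
    intro h
    obtain ⟨c, hc, hbound⟩ := WindowedExp.toeplitz_bounded_below_of_isFrame hg h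
    rw [WindowedExp.zero_notMem_Icc_essInf_essSup_iff hg]
    exact WindowedExp.exists_ae_le_of_toeplitz_bounded_below hg hc hbound
  tfae_have 3 → 1 := by
    rw [WindowedExp.zero_notMem_Icc_essInf_essSup_iff hg]
    rintro ⟨ε, hε, h⟩
    rw [WindowedExp.system_eq hg]
    exact WindowedExp.isRieszBasis_of_bijective _ _ (WindowedExp.systemOp_bijective hg hε
      (WindowedExp.toeplitz_bounded_below_of_le hg h))
  tfae_finish
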